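/- An \emph{algebra} is a nonempty, possibly infinite set $A$ equipped with an arbitrary family of finitary operations. $\mathrm{Con}(A)$ denotes the set of congruences of $A$ ordered by inclusion, and $\mathrm{Princ}(A)\subseteq\mathrm{Con}(A)$ the set of principal congruences, i.e. those of the form $\mathrm{con}(a,b)$, the least congruence containing $(a,b)$, with $a,b\in A$. In particular, this applies to a lattice, regarded as an algebra with the operations $\vee,\wedge$. For a subset $Q$ of a finite lattice $D$, we say that $A$ \emph{represents the inclusion $Q\subseteq D$ by principal congruences} if there is an isomorphism $\varphi\colon \mathrm{Con}(A)\to D$ such that $\varphi(\mathrm{Princ}(A))=Q$. Let $J(D)$ be the set of nonzero join-irreducible elements of $D$. Corollary 1.4. Let $D$ be a finite (nonempty) distributive lattice. Suppose that for every $Q$ with $J(D)\cup\{0\}\subseteq Q\subseteq D$, the inclusion $Q\subseteq D$ is represented by the principal congruences of some algebra. Then for every $Q$ with $J(D)\cup\{0,1\}\subseteq Q\subseteq D$, the inclusion $Q\subseteq D$ is represented by the principal congruences of some finite lattice. -/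

import Mathlib

namespace PrincCong

/-- A congruence of an algebra `A` with (finitary) operations named by the function symbols of
`L`: an equivalence relation compatible with all operations. -/
@[ext]
structure AlgCon (L : FirstOrder.Language) (A : Type*) [L.Structure A] extends Setoid A where
  compat : ∀ {n : ℕ} (f : L.Functions n) (x y : Fin n → A),
    (∀ i, r (x i) (y i)) →
      r (FirstOrder.Language.Structure.funMap f x) (FirstOrder.Language.Structure.funMap f y)

theorem AlgCon.toSetoid_injective {L : FirstOrder.Language} {A : Type*} [L.Structure A] :
    Function.Injective (AlgCon.toSetoid : AlgCon L A → Setoid A) := by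
  rintro ⟨s, hs⟩ ⟨t, ht⟩ h
  cases h
  rfl

/-- `Con(A)`, ordered by inclusion. -/
instance AlgCon.instPartialOrder (L : FirstOrder.Language) (A : Type*) [L.Structure A] :
    PartialOrder (AlgCon L A) :=
  PartialOrder.lift AlgCon.toSetoid AlgCon.toSetoid_injective

/-- `Princ(A)`: the congruences of the form `con(a, b)`, the least congruence that
contains the pair `(a, b)`. -/
def AlgCon.principal (L : FirstOrder.Language) (A : Type*) [L.Structure A] : Set (AlgCon L A) :=
  {θ | ∃ a b : A, IsLeast {c : AlgCon L A | c.r a b} θ}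

theorem latticeCon_toSetoid_injective {K : Type*} [Lattice K] :
    Function.Injective (LatticeCon.toSetoid : LatticeCon K → Setoid K) := by
  rintro ⟨s, hs, hs'⟩ ⟨t, ht, ht'⟩ h
  cases h
  rfl

/-- `Con(K)` for a lattice `K`, ordered by inclusion. -/
instance latticeConPartialOrder (K : Type*) [Lattice K] : PartialOrder (LatticeCon K) :=
  PartialOrder.lift LatticeCon.toSetoid latticeCon_toSetoid_injective

/-- `Princ(K)` for a lattice `K`: the congruences of the form `con(a, b)`. -/
def latticePrincipal (K : Type*) [Lattice K] : Set (LatticeCon K) :=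
  {θ | ∃ a b : K, IsLeast {c : LatticeCon K | c.r a b} θ}

/-- The algebra `A` represents the inclusion `Q ⊆ D` by principal congruences. -/
def AlgRepresents (L : FirstOrder.Language) (A : Type*) [L.Structure A] {D : Type*} [Lattice D]
    (Q : Set D) : Prop :=
  ∃ φ : AlgCon L A ≃o D, Q = φ '' AlgCon.principal L A

/-- The lattice `K` represents the inclusion `Q ⊆ D` by principal congruences. -/
def LatticeRepresents (K : Type*) [Lattice K] {D : Type*} [Lattice D] (Q : Set D) : Prop :=
  ∃ φ : LatticeCon K ≃o D, Q = φ '' latticePrincipal K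

/-- `J₀(D)`: the nonzero join-irreducible elements together with `0`. -/
def J₀ (D : Type*) [Lattice D] [BoundedOrder D] : Set D := {x | SupIrred x} ∪ {⊥}

/-- `J⁺(D)`: the nonzero join-irreducible elements together with `0` and `1`. -/
def JPlus (D : Type*) [Lattice D] [BoundedOrder D] : Set D := {x | SupIrred x} ∪ {⊥, ⊤}

/-- Full A-representability: every `Q` with `J₀(D) ⊆ Q ⊆ D` is represented by the principal
congruences of some (possibly infinite) algebra of some type. -/
def FullyARepresentable.{u, w, d} (D : Type d) [Lattice D] [BoundedOrder D] : Prop :=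
  ∀ Q : Set D, J₀ D ⊆ Q →
    ∃ (L : FirstOrder.Language.{u, 0}) (_ : L.IsAlgebraic) (A : Type w) (_ : Nonempty A)
      (_ : L.Structure A), AlgRepresents L A Q

/-- Full FL-representability: every `Q` with `J⁺(D) ⊆ Q ⊆ D` is represented by the principal
congruences of some finite lattice. -/
def FullyFLRepresentable.{d} (D : Type d) [Lattice D] [BoundedOrder D] : Prop :=
  ∀ Q : Set D, JPlus D ⊆ Q →
    ∃ (K : Type) (_ : Finite K) (_ : Nonempty K) (_ : Lattice K), LatticeRepresents K Q

end PrincCong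

universe u w d

/-!
Call the element of `D` corresponding to `con(x, y)` the distance of `x` and `y`; it satisfies the
ultrametric inequality, and its values are exactly the elements of `Q`.

*Necessary conditions.* If `T` is the join of irreducibles `pᵢ`, a pair at distance `T` is linked by
a chain each step of which has distance below some `pᵢ`. If `Q = J₀(D) ∪ {T}`, the first point of
the chain at distance `T` from its origin exhibits `T` as a join of two elements of `J₀(D)`. If
`Q = J₀(D)` and `1 = p ⊔ q` with `p, q ∈ J₀(D)`, every distance is join-prime or `0`, hence below
`p` or below `q`, so the algebra is covered by two of its congruences; one of them is then total,
and `1 ∈ J₀(D)`.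

*Construction.* Suppose that `1` is irreducible and that every element of `D` is a join of two
elements of `J₀(D)`. Take three vertices of each irreducible colour and call a set of vertices a
face if all joins of its colours lie in `Q`, except that vertices of colour `1` are isolated. The
representing lattice consists of the faces with some of their vertices raised, with a top element
adjoined. Moving to another face is a change of distance `1`, and within a face the distance is the
join of the colours of the vertices whose level changes. Because of the three isolated vertices, a
congruence that relates different faces is total; any other congruence is determined by the colours
whose two levels it identifies.
-/

namespace PrincCong

open Relation (ReflTransGen)
open scoped symmDiff

section Algebra

theorem setoid_eq_top_or_eq_top {A : Type*} {r s : Setoid A} (h : ∀ x y, r x y ∨ s x y) :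
    r = ⊤ ∨ s = ⊤ := by
  by_contra! hne
  obtain ⟨x, y, hxy⟩ : ∃ x y, ¬ r x y := by simpa [Setoid.eq_top_iff] using hne.1
  have hs (z : A) : s x z := by
    by_contra hz
    have hxz : r x z := (h x z).resolve_right hz
    rcases h y z with hyz | hyz
    · exact hxy (r.trans hxz (r.symm hyz))
    · exact hz (s.trans ((h x y).resolve_left hxy) hyz)
  exact hne.2 (Setoid.eq_top_iff.2 fun y z => s.trans (s.symm (hs y)) (hs z))

theorem reflTransGen_of_forall_update {ι A B : Type*} [Finite ι] [DecidableEq ι]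
    {r : A → A → Prop} {s : B → B → Prop} {f : (ι → A) → B}
    (hf : ∀ x i a b, r a b → s (f (Function.update x i a)) (f (Function.update x i b)))
    {x y : ι → A} (h : ∀ i, ReflTransGen r (x i) (y i)) : ReflTransGen s (f x) (f y) := by
  have := Fintype.ofFinite ι
  suffices ∀ t : Finset ι, ReflTransGen s (f x) (f (t.piecewise y x)) by
    simpa using this Finset.univ
  intro t
  induction t using Finset.induction_on with
  | empty => simpa using ReflTransGen.refl
  | insert i t hi ih =>
    have hx : t.piecewise y x = Function.update (t.piecewise y x) i (x i) := by
      rw [eq_comm, Function.update_eq_self_iff, Finset.piecewise_eq_of_notMem _ _ _ hi]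
    refine ih.trans ?_
    rw [Finset.piecewise_insert, hx, Function.update_idem]
    exact ReflTransGen.lift (fun a => f (Function.update (t.piecewise y x) i a))
      (fun a b => hf _ i a b) _ _ (h i)

variable {L : FirstOrder.Language} {A : Type*} [L.Structure A]

namespace AlgCon

theorem le_iff {c c' : AlgCon L A} : c ≤ c' ↔ ∀ x y, c.r x y → c'.r x y :=
  ⟨fun h _ _ hxy => h hxy, fun h x y hxy => h x y hxy⟩

variable (L) in
/-- The congruence `con(a, b)`, as the intersection of all congruences containing `(a, b)`. -/
def con (a b : A) : AlgCon L A where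
  r x y := ∀ c : AlgCon L A, c.r a b → c.r x y
  iseqv :=
    ⟨fun x c _ => c.iseqv.refl x, fun h c hc => c.iseqv.symm (h c hc),
      fun h h' c hc => c.iseqv.trans (h c hc) (h' c hc)⟩
  compat f x y h c hc := c.compat f x y fun i => h i c hc

theorem isLeast_con (a b : A) : IsLeast {c : AlgCon L A | c.r a b} (con L a b) :=
  ⟨fun _ hc => hc, fun c hc => le_iff.2 fun _ _ h => h c hc⟩

theorem con_le_iff {a b : A} {c : AlgCon L A} : con L a b ≤ c ↔ c.r a b :=
  ⟨fun h => le_iff.1 h _ _ (isLeast_con a b).1, fun h => (isLeast_con a b).2 h⟩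

theorem mem_principal_iff {c : AlgCon L A} : c ∈ principal L A ↔ ∃ a b, con L a b = c :=
  exists₂_congr fun a b => ⟨fun h => (isLeast_con a b).unique h, fun h => h ▸ isLeast_con a b⟩

/-- The join of a set `S` of congruences: two elements are related if they are linked by a chain
each step of which lies in a member of `S`. -/
def chainCon (S : Set (AlgCon L A)) : AlgCon L A where
  r := ReflTransGen fun x y => ∃ c ∈ S, c.r x y
  iseqv :=
    ⟨fun _ => .refl,
      fun h => ReflTransGen.mono (fun _ _ ⟨c, hc, hxy⟩ => ⟨c, hc, c.iseqv.symm hxy⟩) _ _ h.swap,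
      fun h h' => h.trans h'⟩
  compat f x y h := by
    refine reflTransGen_of_forall_update (fun z i a b ⟨c, hc, hab⟩ => ⟨c, hc, ?_⟩) h
    refine c.compat f _ _ fun j => ?_
    rcases eq_or_ne j i with rfl | hj
    · simpa using hab
    · simp [hj]

theorem le_chainCon {S : Set (AlgCon L A)} {c : AlgCon L A} (hc : c ∈ S) : c ≤ chainCon S :=
  le_iff.2 fun _ _ h => .single ⟨c, hc, h⟩

section Dist

variable {D : Type*} [Lattice D]

/-- The distance of `x` and `y`: the element of `D` that corresponds to `con(x, y)` under an
isomorphism `Con(A) ≃ D`. -/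
def dist (φ : AlgCon L A ≃o D) (x y : A) : D := φ (con L x y)

theorem dist_le_iff (φ : AlgCon L A ≃o D) {x y : A} {d : D} :
    dist φ x y ≤ d ↔ (φ.symm d).r x y := by
  rw [dist, ← φ.le_symm_apply, con_le_iff]

theorem dist_self [OrderBot D] (φ : AlgCon L A ≃o D) (x : A) : dist φ x x = ⊥ :=
  le_bot_iff.1 ((dist_le_iff φ).2 ((φ.symm ⊥).iseqv.refl x))

theorem dist_triangle (φ : AlgCon L A ≃o D) (x y z : A) :
    dist φ x z ≤ dist φ x y ⊔ dist φ y z :=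
  (dist_le_iff φ).2 <| (φ.symm _).iseqv.trans ((dist_le_iff φ).1 le_sup_left)
    ((dist_le_iff φ).1 le_sup_right)

theorem mem_image_principal_iff (φ : AlgCon L A ≃o D) {d : D} :
    d ∈ φ '' principal L A ↔ ∃ x y, dist φ x y = d := by
  simp only [Set.mem_image, mem_principal_iff, dist]
  exact ⟨fun ⟨_, ⟨x, y, h⟩, hd⟩ => ⟨x, y, h ▸ hd⟩, fun ⟨x, y, h⟩ => ⟨_, ⟨x, y, rfl⟩, h⟩⟩

theorem reflTransGen_of_dist_le_sup [OrderBot D] (φ : AlgCon L A ≃o D) {s : Finset D} {x y : A}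
    (h : dist φ x y ≤ s.sup id) : ReflTransGen (fun u v => ∃ p ∈ s, dist φ u v ≤ p) x y := by
  have hs : φ.symm (s.sup id) ≤ chainCon (φ.symm '' s) := by
    rw [φ.symm_apply_le]
    exact Finset.sup_le fun p hp => φ.symm_apply_le.1 (le_chainCon (Set.mem_image_of_mem _ hp))
  refine ReflTransGen.mono ?_ _ _ (le_iff.1 hs x y ((dist_le_iff φ).1 h))
  rintro u v ⟨_, ⟨p, hp, rfl⟩, huv⟩
  exact ⟨p, hp, (dist_le_iff φ).2 huv⟩

end Dist

end AlgCon

open AlgCon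

theorem AlgRepresents.exists_sup_eq {D : Type*} [Lattice D] [BoundedOrder D] [WellFoundedLT D]
    {T : D} (h : AlgRepresents L A (J₀ D ∪ {T})) : ∃ p ∈ J₀ D, ∃ q ∈ J₀ D, p ⊔ q = T := by
  obtain ⟨φ, hφ⟩ := h
  have hdist (x y : A) : dist φ x y ∈ J₀ D ∪ {T} := hφ ▸ (mem_image_principal_iff φ).2 ⟨x, y, rfl⟩
  obtain ⟨a, b, hab⟩ : ∃ a b, dist φ a b = T := (mem_image_principal_iff φ).1 (hφ ▸ Or.inr rfl)
  obtain ⟨s, hs, hirr⟩ := exists_supIrred_decomposition T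
  by_contra! hne
  -- Where the distance from `a` first becomes `T`, `T` would be the join of the previous distance
  -- and of an irreducible.
  have hchain (y : A) (hy : ReflTransGen (fun u v => ∃ p ∈ s, dist φ u v ≤ p) a y) :
      dist φ a y ∈ J₀ D ∧ dist φ a y ≤ T := by
    induction hy with
    | refl => exact dist_self φ a ▸ ⟨Or.inr rfl, bot_le⟩
    | @tail x y _ hxy ih =>
      obtain ⟨p, hp, hxy⟩ := hxy
      have hstep : dist φ a y ≤ dist φ a x ⊔ p :=
        (dist_triangle φ a x y).trans (sup_le_sup_left hxy _)
      have hle : dist φ a x ⊔ p ≤ T := sup_le ih.2 (hs ▸ Finset.le_sup (f := id) hp)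
      refine ⟨(hdist a y).resolve_right fun hy => ?_, hstep.trans hle⟩
      exact hne _ ih.1 p (Or.inl (hirr hp)) (hle.antisymm (Set.mem_singleton_iff.1 hy ▸ hstep))
  have hT : T ∈ J₀ D := hab ▸ (hchain b (reflTransGen_of_dist_le_sup φ (hab.trans hs.symm).le)).1
  exact hne T hT T hT (sup_idem T)

theorem AlgRepresents.top_mem_J₀ {D : Type*} [DistribLattice D] [BoundedOrder D]
    (h : AlgRepresents L A (J₀ D)) {p q : D} (hp : p ∈ J₀ D) (hq : q ∈ J₀ D) (hpq : p ⊔ q = ⊤) :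
    ⊤ ∈ J₀ D := by
  obtain ⟨φ, hφ⟩ := h
  have hcover (x y : A) : (φ.symm p).r x y ∨ (φ.symm q).r x y := by
    rw [← dist_le_iff, ← dist_le_iff]
    have hxy : dist φ x y ∈ J₀ D := hφ ▸ (mem_image_principal_iff φ).2 ⟨x, y, rfl⟩
    rcases hxy with hirr | hbot
    · exact (supPrime_iff_supIrred.2 hirr).2 (hpq ▸ le_top)
    · exact Or.inl (Set.mem_singleton_iff.1 hbot ▸ bot_le)
  have eq_top {d : D} (hd : (φ.symm d).toSetoid = ⊤) : d = ⊤ := by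
    refine top_le_iff.1 (φ.symm.le_iff_le.1 (le_iff.2 fun x y _ => ?_))
    exact Setoid.eq_top_iff.1 hd x y
  rcases setoid_eq_top_or_eq_top hcover with h | h
  · exact eq_top h ▸ hp
  · exact eq_top h ▸ hq

end Algebra

namespace FullyARepresentable

theorem exists_sup_eq {D : Type d} [Lattice D] [BoundedOrder D] [WellFoundedLT D]
    (h : FullyARepresentable.{u, w, d} D) (T : D) : ∃ p ∈ J₀ D, ∃ q ∈ J₀ D, p ⊔ q = T := by
  obtain ⟨L, _, A, _, _, hA⟩ := h (J₀ D ∪ {T}) Set.subset_union_left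
  exact hA.exists_sup_eq

theorem top_mem_J₀ {D : Type d} [DistribLattice D] [BoundedOrder D] [WellFoundedLT D]
    (h : FullyARepresentable.{u, w, d} D) : ⊤ ∈ J₀ D := by
  obtain ⟨p, hp, q, hq, hpq⟩ := h.exists_sup_eq ⊤
  obtain ⟨L, _, A, _, _, hA⟩ := h (J₀ D) subset_rfl
  exact hA.top_mem_J₀ hp hq hpq

end FullyARepresentable

theorem latticeRepresents_of_dist {K D : Type*} [Lattice K] [Lattice D] [OrderBot D]
    [WellFoundedLT D] {Q : Set D} (dist : K → K → D) (con : D → LatticeCon K)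
    (hcon : ∀ d x y, (con d).r x y ↔ dist x y ≤ d) (hsurj : Function.Surjective con)
    (hQ : ∀ d, d ∈ Q ↔ ∃ x y, dist x y = d) (hirr : {p : D | SupIrred p} ⊆ Q) :
    LatticeRepresents K Q := by
  have le_iff (d d' : D) : con d ≤ con d' ↔ d ≤ d' := by
    constructor
    · intro h
      obtain ⟨s, rfl, hs⟩ := exists_supIrred_decomposition d
      refine Finset.sup_le fun p hp => ?_
      obtain ⟨x, y, rfl⟩ := (hQ p).1 (hirr (hs hp))
      exact (hcon d' x y).1 (h ((hcon _ x y).2 (Finset.le_sup (f := id) hp)))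
    · exact fun h x y hxy => (hcon d' x y).2 (((hcon d x y).1 hxy).trans h)
  let ψ : D ≃o LatticeCon K := RelIso.ofSurjective (OrderEmbedding.ofMapLEIff con le_iff) hsurj
  have isLeast (x y : K) : IsLeast {c : LatticeCon K | c.r x y} (ψ (dist x y)) := by
    refine ⟨(hcon _ x y).2 le_rfl, fun c hc => ?_⟩
    obtain ⟨d, rfl⟩ := ψ.surjective c
    exact ψ.monotone ((hcon d x y).1 hc)
  refine ⟨ψ.symm, Set.ext fun d => (hQ d).trans ⟨?_, ?_⟩⟩
  · rintro ⟨x, y, rfl⟩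
    exact ⟨_, ⟨x, y, isLeast x y⟩, ψ.symm_apply_apply _⟩
  · rintro ⟨c, ⟨x, y, hc⟩, rfl⟩
    exact ⟨x, y, by rw [← (isLeast x y).unique hc, ψ.symm_apply_apply]⟩

/-- An abstract simplicial complex on `V`, the empty set being a face as well, with vertices
coloured by elements of `D`. The closure conditions are those that make the complex determine a
lattice of cells, see `ColoredComplex.Cell`, whose congruences are given by sets of colours. -/
structure ColoredComplex (V D : Type*) [DecidableEq V] [LE D] [OrderTop D] where
  col : V → D
  faces : LowerSet (Finset V)
  empty_mem : ∅ ∈ faces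
  singleton_mem : ∀ v, {v} ∈ faces
  pair_mem : ∀ {v w}, col w ≤ col v → col v ≠ ⊤ → {v, w} ∈ faces
  subset_singleton : ∀ {s}, s ∈ faces → ∀ {v}, v ∈ s → col v = ⊤ → s ⊆ {v}

namespace ColoredComplex

section Cells

variable {V D : Type*} [DecidableEq V] [PartialOrder D] [OrderTop D] {C : ColoredComplex V D}

/-- A face `base` with each vertex at its lower level or, if it belongs to `up`, at its upper level.
Vertices of colour `⊤` have no upper level, and raising a vertex raises all vertices of smaller
colour in the face. -/
@[ext]
structure Cell (C : ColoredComplex V D) where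
  base : Finset V
  up : Finset V
  base_mem : base ∈ C.faces
  up_subset : up ⊆ base
  col_ne_top : ∀ {v}, v ∈ up → C.col v ≠ ⊤
  mem_up_of_le : ∀ {v w}, v ∈ up → w ∈ base → C.col w ≤ C.col v → w ∈ up

namespace Cell

theorem prod_injective : Function.Injective fun x : C.Cell => (x.base, x.up) := fun _ _ h =>
  Cell.ext (congrArg Prod.fst h) (congrArg Prod.snd h)

instance [Finite V] : Finite C.Cell := Finite.of_injective _ prod_injective

instance : PartialOrder C.Cell := PartialOrder.lift _ prod_injective

theorem le_iff {x y : C.Cell} : x ≤ y ↔ x.base ⊆ y.base ∧ x.up ⊆ y.up := Iff.rfl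

/-- The face `s` with all its vertices at their lower level. -/
def low (s : Finset V) (hs : s ∈ C.faces) : C.Cell where
  base := s
  up := ∅
  base_mem := hs
  up_subset := s.empty_subset
  col_ne_top := by simp
  mem_up_of_le := by simp

open Classical in
/-- The face `s` with all its vertices at their highest level. -/
noncomputable def high (s : Finset V) (hs : s ∈ C.faces) : C.Cell where
  base := s
  up := s.filter (C.col · ≠ ⊤)
  base_mem := hs
  up_subset := s.filter_subset _
  col_ne_top hv := (Finset.mem_filter.1 hv).2
  mem_up_of_le hv hw h := Finset.mem_filter.2
    ⟨hw, ne_top_of_le_ne_top (Finset.mem_filter.1 hv).2 h⟩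

theorem low_le_iff {s : Finset V} {hs : s ∈ C.faces} {x : C.Cell} : low s hs ≤ x ↔ s ⊆ x.base :=
  and_iff_left x.up.empty_subset

theorem mem_up_high {s : Finset V} {hs : s ∈ C.faces} {v : V} :
    v ∈ (high s hs).up ↔ v ∈ s ∧ C.col v ≠ ⊤ := by
  simp [high]

instance : OrderBot C.Cell where
  bot := low ∅ C.empty_mem
  bot_le _ := low_le_iff.2 (Finset.empty_subset _)

instance : SemilatticeInf C.Cell where
  inf x y :=
    { base := x.base ∩ y.base
      up := x.up ∩ y.up
      base_mem := C.faces.lower Finset.inter_subset_left x.base_mem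
      up_subset := Finset.inter_subset_inter x.up_subset y.up_subset
      col_ne_top hv := x.col_ne_top (Finset.mem_inter.1 hv).1
      mem_up_of_le := by
        intro v w hv hw h
        rw [Finset.mem_inter] at hv hw ⊢
        exact ⟨x.mem_up_of_le hv.1 hw.1 h, y.mem_up_of_le hv.2 hw.2 h⟩ }
  inf_le_left _ _ := ⟨Finset.inter_subset_left, Finset.inter_subset_left⟩
  inf_le_right _ _ := ⟨Finset.inter_subset_right, Finset.inter_subset_right⟩
  le_inf _ _ _ h h' := ⟨Finset.subset_inter h.1 h'.1, Finset.subset_inter h.2 h'.2⟩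

theorem base_inf (x y : C.Cell) : (x ⊓ y).base = x.base ∩ y.base := rfl

theorem up_inf (x y : C.Cell) : (x ⊓ y).up = x.up ∩ y.up := rfl

open Classical in
/-- The join of two cells whose bases span a face. -/
noncomputable def join (x y : C.Cell) (h : x.base ∪ y.base ∈ C.faces) : C.Cell where
  base := x.base ∪ y.base
  up := (x.base ∪ y.base).filter fun w => ∃ v ∈ x.up ∪ y.up, C.col w ≤ C.col v
  base_mem := h
  up_subset := Finset.filter_subset _ _
  col_ne_top := by
    intro w hw
    obtain ⟨v, hv, hwv⟩ := (Finset.mem_filter.1 hw).2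
    exact ne_top_of_le_ne_top ((Finset.mem_union.1 hv).elim x.col_ne_top y.col_ne_top) hwv
  mem_up_of_le := by
    intro w w' hw hw' h
    obtain ⟨v, hv, hwv⟩ := (Finset.mem_filter.1 hw).2
    exact Finset.mem_filter.2 ⟨hw', v, hv, h.trans hwv⟩

theorem mem_up_join {x y : C.Cell} {h : x.base ∪ y.base ∈ C.faces} {w : V} :
    w ∈ (x.join y h).up ↔ w ∈ x.base ∪ y.base ∧ ∃ v ∈ x.up ∪ y.up, C.col w ≤ C.col v := by
  simp only [join, Finset.mem_filter]

theorem join_le_iff {x y z : C.Cell} {h : x.base ∪ y.base ∈ C.faces} :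
    x.join y h ≤ z ↔ x ≤ z ∧ y ≤ z := by
  have mem_up {v : V} (hv : v ∈ x.up ∪ y.up) : v ∈ (x.join y h).up :=
    mem_up_join.2 ⟨Finset.union_subset_union x.up_subset y.up_subset hv, v, hv, le_rfl⟩
  constructor
  · rintro ⟨hbase, hup⟩
    exact ⟨⟨Finset.subset_union_left.trans hbase, fun v hv => hup (mem_up (by simp [hv]))⟩,
      ⟨Finset.subset_union_right.trans hbase, fun v hv => hup (mem_up (by simp [hv]))⟩⟩
  · rintro ⟨hx, hy⟩
    have hbase : x.base ∪ y.base ⊆ z.base := Finset.union_subset hx.1 hy.1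
    refine ⟨hbase, fun w (hw : w ∈ (x.join y h).up) => ?_⟩
    obtain ⟨hwb, v, hv, hwv⟩ := mem_up_join.1 hw
    exact z.mem_up_of_le (Finset.union_subset hx.2 hy.2 hv) (hbase hwb) hwv

open Classical in
/-- The join in the lattice of cells with a top element adjoined. -/
noncomputable def sup : WithTop C.Cell → WithTop C.Cell → WithTop C.Cell
  | (x : C.Cell), (y : C.Cell) => if h : x.base ∪ y.base ∈ C.faces then (x.join y h : C.Cell) else ⊤
  | _, _ => ⊤

theorem sup_le_iff {x y z : WithTop C.Cell} : sup x y ≤ z ↔ x ≤ z ∧ y ≤ z := by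
  induction z with
  | top => simp
  | coe z =>
    induction x with
    | top => simp [sup]
    | coe x =>
      induction y with
      | top => simp [sup]
      | coe y =>
        by_cases h : x.base ∪ y.base ∈ C.faces
        · simp [sup, h, join_le_iff]
        · have hne : ¬ (x ≤ z ∧ y ≤ z) := fun hz =>
            h (C.faces.lower (Finset.union_subset hz.1.1 hz.2.1) z.base_mem)
          simpa [sup, h] using hne

noncomputable instance : Lattice (WithTop C.Cell) where
  __ := (inferInstance : SemilatticeInf (WithTop C.Cell))
  sup := sup
  le_sup_left _ _ := (sup_le_iff.1 le_rfl).1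
  le_sup_right _ _ := (sup_le_iff.1 le_rfl).2
  sup_le _ _ _ hx hy := sup_le_iff.2 ⟨hx, hy⟩

theorem coe_sup_coe {x y : C.Cell} (h : x.base ∪ y.base ∈ C.faces) :
    (x ⊔ y : WithTop C.Cell) = (x.join y h : C.Cell) := dif_pos h

theorem coe_sup_coe_eq_top {x y : C.Cell} (h : x.base ∪ y.base ∉ C.faces) :
    (x ⊔ y : WithTop C.Cell) = ⊤ := dif_neg h

end Cell

/-- The face of a cell, and `⊤` for the adjoined top element. -/
def supp (x : WithTop C.Cell) : WithTop (Finset V) := x.map Cell.base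

/-- The raised vertices of a cell; the adjoined top element has none. -/
def raised (x : WithTop C.Cell) : Finset V := (x.map Cell.up).untopD ∅

theorem eq_or_exists_of_supp_eq {x y : WithTop C.Cell} (h : supp x = supp y) :
    x = y ∨ ∃ a b : C.Cell, x = a ∧ y = b ∧ a.base = b.base := by
  induction x <;> induction y <;> simp_all [supp]

end Cells

section Dist

open Cell

variable {V D : Type*} [DecidableEq V] [Lattice D] [BoundedOrder D] {C : ColoredComplex V D}

/-- Two cells with the same face are separated by the colours of the vertices whose level changes,
all other pairs by `⊤`. This is the element of `D` that corresponds to `con(x, y)`. -/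
def dist (x y : WithTop C.Cell) : D :=
  if supp x = supp y then (raised x ∆ raised y).sup C.col else ⊤

theorem dist_self (x : WithTop C.Cell) : dist x x = ⊥ := by simp [dist]

theorem dist_comm (x y : WithTop C.Cell) : dist x y = dist y x := by
  simp [dist, symmDiff_comm, eq_comm]

theorem dist_triangle (x y z : WithTop C.Cell) : dist x z ≤ dist x y ⊔ dist y z := by
  by_cases hxy : supp x = supp y
  · by_cases hyz : supp y = supp z
    · rw [dist, dist, dist, if_pos hxy, if_pos hyz, if_pos (hxy.trans hyz), ← Finset.sup_union]
      exact Finset.sup_mono (symmDiff_triangle _ _ _)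
    · simp [dist, hyz]
  · simp [dist, hxy]

theorem dist_coe {a b : C.Cell} (h : a.base = b.base) :
    dist (a : WithTop C.Cell) b = (a.up ∆ b.up).sup C.col := by
  simp [dist, supp, raised, h]

theorem dist_low_high {s : Finset V} (hs : s ∈ C.faces) (h : ∀ v ∈ s, C.col v ≠ ⊤) :
    dist (low s hs : WithTop C.Cell) (high s hs) = s.sup C.col := by
  have hup : (low s hs).up ∆ (high s hs).up = s := (bot_symmDiff _).trans
    (Finset.ext fun v => mem_up_high.trans (and_iff_left_of_imp (h v)))
  rw [dist_coe (a := low s hs) (b := high s hs) rfl, hup]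

theorem dist_inf_le (x y z : WithTop C.Cell) : dist (x ⊓ z) (y ⊓ z) ≤ dist x y := by
  by_cases h : supp x = supp y
  · obtain rfl | ⟨a, b, rfl, rfl, hab⟩ := eq_or_exists_of_supp_eq h
    · simp [dist_self]
    · induction z with
      | top => simp
      | coe z =>
        rw [← WithTop.coe_inf, ← WithTop.coe_inf, dist_coe (by simp only [base_inf, hab]),
          dist_coe hab, up_inf, up_inf]
        exact Finset.sup_mono (inf_symmDiff_distrib_right a.up b.up z.up ▸ inf_le_left)
  · simp [dist, h]

theorem dist_sup_le (x y z : WithTop C.Cell) : dist (x ⊔ z) (y ⊔ z) ≤ dist x y := by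
  by_cases h : supp x = supp y
  · obtain rfl | ⟨a, b, rfl, rfl, hab⟩ := eq_or_exists_of_supp_eq h
    · simp [dist_self]
    · induction z with
      | top => simp [dist_self]
      | coe z =>
        by_cases haz : a.base ∪ z.base ∈ C.faces
        · have hbz : b.base ∪ z.base ∈ C.faces := hab ▸ haz
          rw [coe_sup_coe haz, coe_sup_coe hbz, dist_coe (by simp only [join, hab]), dist_coe hab]
          refine Finset.sup_le fun w hw => ?_
          -- Some raised `v` of larger colour raises `w` in only one of the two joins.
          obtain ⟨v, hv, hwv⟩ : ∃ v ∈ a.up ∆ b.up, C.col w ≤ C.col v := by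
            simp only [Finset.mem_symmDiff, mem_up_join, Finset.mem_union] at hw ⊢
            grind
          exact hwv.trans (Finset.le_sup hv)
        · rw [coe_sup_coe_eq_top haz, coe_sup_coe_eq_top (hab ▸ haz), dist_self]
          exact bot_le
  · simp [dist, h]

/-- The congruence that identifies the elements at distance at most `d`. -/
def con (C : ColoredComplex V D) (d : D) : LatticeCon (WithTop C.Cell) where
  r x y := dist x y ≤ d
  iseqv :=
    ⟨fun x => dist_self x ▸ bot_le, fun {x y} h => dist_comm x y ▸ h,
      fun {x y z} h h' => (dist_triangle x y z).trans (sup_le h h')⟩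
  inf {w x y z} h h' := by
    refine (dist_triangle _ (x ⊓ y) _).trans (sup_le ((dist_inf_le w x y).trans h) ?_)
    rw [inf_comm x, inf_comm x]
    exact (dist_inf_le y z x).trans h'
  sup {w x y z} h h' := by
    refine (dist_triangle _ (x ⊔ y) _).trans (sup_le ((dist_sup_le w x y).trans h) ?_)
    rw [sup_comm x, sup_comm x]
    exact (dist_sup_le y z x).trans h'

end Dist

theorem latticeCon_rel_of_rel_bot_top {K : Type*} [Lattice K] [BoundedOrder K] {c : LatticeCon K}
    (h : c.r ⊥ ⊤) (x y : K) : c.r x y := by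
  have bot_rel (z : K) : c.r ⊥ z := by simpa using c.inf h (c.iseqv.refl z)
  exact c.iseqv.trans (c.iseqv.symm (bot_rel x)) (bot_rel y)

theorem latticeCon_rel_finset_sup {ι K : Type*} [Lattice K] [OrderBot K] {c : LatticeCon K}
    {s : Finset ι} {f g : ι → K} (h : ∀ i ∈ s, c.r (f i) (g i)) : c.r (s.sup f) (s.sup g) := by
  classical
  induction s using Finset.induction_on with
  | empty => exact c.iseqv.refl _
  | insert i s _ ih =>
    rw [Finset.forall_mem_insert] at h
    rw [Finset.sup_insert, Finset.sup_insert]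
    exact c.sup h.1 (ih h.2)

section Congruences

open Cell

variable {V D : Type*} [DecidableEq V] [PartialOrder D] [OrderTop D] {C : ColoredComplex V D}

/-- The vertex `v` at its lower level. -/
abbrev lowVertex (C : ColoredComplex V D) (v : V) : C.Cell := low {v} (C.singleton_mem v)

/-- The vertex `v` at its highest level. -/
noncomputable abbrev highVertex (C : ColoredComplex V D) (v : V) : C.Cell :=
  high {v} (C.singleton_mem v)

theorem lowVertex_le_iff {v : V} {a : C.Cell} : C.lowVertex v ≤ a ↔ v ∈ a.base :=
  low_le_iff.trans Finset.singleton_subset_iff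

theorem lowVertex_le_highVertex (v : V) : C.lowVertex v ≤ C.highVertex v :=
  lowVertex_le_iff.2 (Finset.mem_singleton_self v)

theorem highVertex_le_iff {v : V} {a : C.Cell} (hv : C.col v ≠ ⊤) :
    C.highVertex v ≤ a ↔ v ∈ a.up := by
  have mem_up : v ∈ (C.highVertex v).up := mem_up_high.2 ⟨Finset.mem_singleton_self v, hv⟩
  refine ⟨fun h => h.2 mem_up, fun h => ⟨?_, fun w hw => ?_⟩⟩
  · exact Finset.singleton_subset_iff.2 (a.up_subset h)
  · rwa [Finset.mem_singleton.1 (mem_up_high (hs := C.singleton_mem v).1 hw).1]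

theorem inf_lowVertex_of_notMem {a : C.Cell} {v : V} (hv : v ∉ a.base) :
    a ⊓ C.lowVertex v = ⊥ := by
  have hbase : a.base ∩ {v} ⊆ ∅ := (Finset.inter_singleton_of_notMem hv).subset
  exact le_bot_iff.1 ⟨hbase, Finset.inter_subset_right⟩

theorem inf_highVertex_of_notMem {a : C.Cell} {v : V} (hv : v ∈ a.base) (hvu : v ∉ a.up) :
    a ⊓ C.highVertex v = C.lowVertex v := by
  refine le_antisymm (Cell.le_iff.2 ⟨Finset.inter_subset_right, fun w hw => ?_⟩)
    (le_inf (lowVertex_le_iff.2 hv) (lowVertex_le_highVertex v))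
  rw [up_inf, Finset.mem_inter, mem_up_high, Finset.mem_singleton] at hw
  exact absurd hw.1 (hw.2.1 ▸ hvu)

theorem lowVertex_sup_lowVertex_eq_top {v w : V} (hv : C.col v = ⊤) (hvw : v ≠ w) :
    (C.lowVertex v ⊔ C.lowVertex w : WithTop C.Cell) = ⊤ := by
  refine coe_sup_coe_eq_top fun h => hvw ?_
  have hw : w ∈ ({v} : Finset V) := C.subset_singleton h (by simp [low]) hv (by simp [low])
  exact (Finset.mem_singleton.1 hw).symm

variable {c : LatticeCon (WithTop C.Cell)}

/-- The congruence `c` identifies the two levels of the vertex `v`. -/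
def Collapses (c : LatticeCon (WithTop C.Cell)) (v : V) : Prop :=
  C.col v ≠ ⊤ ∧ c.r (C.lowVertex v) (C.highVertex v)

theorem collapses_of_rel_coe {a b : C.Cell} (h : c.r a b) {v : V} (hva : v ∈ a.base)
    (hvau : v ∉ a.up) (hvb : v ∈ b.up) : Collapses c v := by
  have hv : C.col v ≠ ⊤ := b.col_ne_top hvb
  have hmeet := c.inf h (c.iseqv.refl (C.highVertex v : WithTop C.Cell))
  rw [← WithTop.coe_inf, ← WithTop.coe_inf, inf_highVertex_of_notMem hva hvau,
    inf_eq_right.2 ((highVertex_le_iff hv).2 hvb)] at hmeet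
  exact ⟨hv, hmeet⟩

theorem collapses_of_mem_symmDiff {x y : WithTop C.Cell} (h : c.r x y) (hxy : supp x = supp y)
    {v : V} (hv : v ∈ raised x ∆ raised y) : Collapses c v := by
  obtain rfl | ⟨a, b, rfl, rfl, hab⟩ := eq_or_exists_of_supp_eq hxy
  · simp at hv
  · rcases Finset.mem_symmDiff.1 hv with ⟨ha, hb⟩ | ⟨hb, ha⟩
    · exact collapses_of_rel_coe (c.iseqv.symm h) (hab ▸ a.up_subset ha) hb ha
    · exact collapses_of_rel_coe h (hab ▸ b.up_subset hb) ha hb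

theorem Collapses.of_le {v w : V} (hv : Collapses c v) (hwv : C.col w ≤ C.col v) :
    Collapses c w := by
  have hface : {v, w} ∈ C.faces := C.pair_mem hwv hv.1
  have hbase : {v} ∪ {v, w} ∈ C.faces := by simpa using hface
  have hlow := coe_sup_coe (x := C.lowVertex v) (y := low {v, w} hface) hbase
  have hhigh := coe_sup_coe (x := C.highVertex v) (y := low {v, w} hface) hbase
  have hrel := c.sup hv.2 (c.iseqv.refl (low {v, w} hface : WithTop C.Cell))
  rw [hlow, hhigh] at hrel
  refine collapses_of_rel_coe hrel (v := w) ?_ ?_ (mem_up_join.2 ⟨?_, v, ?_, hwv⟩)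
  · simp [join, low]
  · simp [mem_up_join, low]
  · simp [low]
  · simp [mem_up_high, hv.1]

theorem coe_sup_sup_highVertex {a b : C.Cell} (hab : a ≤ b) (hbase : a.base = b.base) :
    (a : WithTop C.Cell) ⊔ (b.up \ a.up).sup (fun v => (C.highVertex v : WithTop C.Cell)) = b := by
  refine le_antisymm (sup_le (WithTop.coe_le_coe.2 hab) (Finset.sup_le fun v hv => ?_))
    (le_of_forall_ge fun z hz => ?_)
  · have hvb : v ∈ b.up := (Finset.mem_sdiff.1 hv).1
    exact WithTop.coe_le_coe.2 ((highVertex_le_iff (b.col_ne_top hvb)).2 hvb)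
  · induction z with
    | top => exact le_top
    | coe z =>
      have haz : a ≤ z := WithTop.coe_le_coe.1 (le_sup_left.trans hz)
      refine WithTop.coe_le_coe.2 ⟨hbase.symm.subset.trans haz.1, fun v hv => ?_⟩
      by_cases hva : v ∈ a.up
      · exact haz.2 hva
      · have hvz : (C.highVertex v : WithTop C.Cell) ≤ z :=
          Finset.sup_le_iff.1 (le_sup_right.trans hz) v (Finset.mem_sdiff.2 ⟨hv, hva⟩)
        exact (highVertex_le_iff (b.col_ne_top hv)).1 (WithTop.coe_le_coe.1 hvz)

theorem rel_of_le {a b : C.Cell} (hab : a ≤ b) (hbase : a.base = b.base)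
    (h : ∀ v ∈ b.up \ a.up, Collapses c v) : c.r a b := by
  have hrel := c.sup (c.iseqv.refl (a : WithTop C.Cell))
    (latticeCon_rel_finset_sup fun v hv => (h v hv).2)
  have hlow : (b.up \ a.up).sup (fun v => (C.lowVertex v : WithTop C.Cell)) ≤ a :=
    Finset.sup_le fun v hv => WithTop.coe_le_coe.2 <|
      lowVertex_le_iff.2 (hbase ▸ b.up_subset (Finset.mem_sdiff.1 hv).1)
  rwa [sup_eq_left.2 hlow, coe_sup_sup_highVertex hab hbase] at hrel

theorem rel_of_supp_eq {x y : WithTop C.Cell} (hxy : supp x = supp y)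
    (h : ∀ v ∈ raised x ∆ raised y, Collapses c v) : c.r x y := by
  obtain rfl | ⟨a, b, rfl, rfl, hab⟩ := eq_or_exists_of_supp_eq hxy
  · exact c.iseqv.refl _
  · have hsub : b.up \ (a ⊓ b).up ⊆ a.up ∆ b.up ∧ a.up \ (a ⊓ b).up ⊆ a.up ∆ b.up := by
      simp [up_inf, Finset.symmDiff_def]
    have ha : c.r (a ⊓ b : C.Cell) a :=
      rel_of_le inf_le_left (by simp [base_inf, hab]) fun v hv => h v (hsub.2 hv)
    have hb : c.r (a ⊓ b : C.Cell) b :=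
      rel_of_le inf_le_right (by simp [base_inf, hab]) fun v hv => h v (hsub.1 hv)
    exact c.iseqv.trans (c.iseqv.symm ha) hb

theorem exists_top_notMem (u : Fin 3 ↪ V) (hu : ∀ i, C.col (u i) = ⊤) {s : Finset V}
    (hs : s ∈ C.faces) : ∃ i j, i ≠ j ∧ u i ∉ s ∧ u j ∉ s := by
  by_cases h : ∃ i, u i ∈ s
  · obtain ⟨i, hi⟩ := h
    have notMem (j : Fin 3) (hj : j ≠ i) : u j ∉ s := fun hjs =>
      hj (u.injective (Finset.mem_singleton.1 (C.subset_singleton hs hi (hu i) hjs)))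
    exact ⟨i + 1, i + 2, by simp, notMem _ (by simp), notMem _ (by simp)⟩
  · push Not at h
    exact ⟨0, 1, by simp, h 0, h 1⟩

theorem rel_bot_top_of_rel_top (u : Fin 3 ↪ V) (hu : ∀ i, C.col (u i) = ⊤) {a : C.Cell}
    (h : c.r a ⊤) : c.r ⊥ ⊤ := by
  have bot_rel {v : V} (hv : v ∉ a.base) : c.r ⊥ (C.lowVertex v) := by
    have hmeet := c.inf h (c.iseqv.refl (C.lowVertex v : WithTop C.Cell))
    rwa [← WithTop.coe_inf, inf_lowVertex_of_notMem hv, top_inf_eq, WithTop.coe_bot] at hmeet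
  obtain ⟨i, j, hij, hi, hj⟩ := exists_top_notMem u hu a.base_mem
  have hjoin := c.sup (bot_rel hi) (bot_rel hj)
  rwa [sup_idem, lowVertex_sup_lowVertex_eq_top (hu i) (u.injective.ne hij)] at hjoin

theorem rel_bot_top_of_mem_base (u : Fin 3 ↪ V) (hu : ∀ i, C.col (u i) = ⊤) {a b : C.Cell}
    (h : c.r a b) {w : V} (hwa : w ∉ a.base) (hwb : w ∈ b.base) : c.r ⊥ ⊤ := by
  have bot_rel := c.inf h (c.iseqv.refl (C.lowVertex w : WithTop C.Cell))
  rw [← WithTop.coe_inf, ← WithTop.coe_inf, inf_lowVertex_of_notMem hwa,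
    inf_eq_right.2 (lowVertex_le_iff.2 hwb), WithTop.coe_bot] at bot_rel
  obtain ⟨i, -, -, hi, -⟩ := exists_top_notMem u hu (C.singleton_mem w)
  have hjoin := c.sup (c.iseqv.refl (C.lowVertex (u i) : WithTop C.Cell)) bot_rel
  rw [sup_bot_eq, lowVertex_sup_lowVertex_eq_top (hu i) (by simpa using hi)] at hjoin
  exact rel_bot_top_of_rel_top u hu hjoin

theorem rel_bot_top_of_supp_ne (u : Fin 3 ↪ V) (hu : ∀ i, C.col (u i) = ⊤)
    {x y : WithTop C.Cell} (h : c.r x y) (hxy : supp x ≠ supp y) : c.r ⊥ ⊤ := by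
  induction x with
  | top =>
    induction y with
    | top => exact absurd rfl hxy
    | coe b => exact rel_bot_top_of_rel_top u hu (c.iseqv.symm h)
  | coe a =>
    induction y with
    | top => exact rel_bot_top_of_rel_top u hu h
    | coe b =>
      have hab : a.base ≠ b.base := fun hab => hxy (by simp [supp, hab])
      obtain ⟨w, ⟨hwa, hwb⟩ | ⟨hwb, hwa⟩⟩ :=
        (Finset.symmDiff_nonempty.2 hab).imp fun _ => Finset.mem_symmDiff.1
      · exact rel_bot_top_of_mem_base u hu (c.iseqv.symm h) hwb hwa
      · exact rel_bot_top_of_mem_base u hu h hwa hwb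

end Congruences

theorem con_surjective {V D : Type*} [DecidableEq V] [Finite V] [DistribLattice D] [BoundedOrder D]
    {C : ColoredComplex V D} (hcol : ∀ v, SupIrred (C.col v)) (u : Fin 3 ↪ V)
    (hu : ∀ i, C.col (u i) = ⊤) : Function.Surjective C.con := by
  classical
  have := Fintype.ofFinite V
  intro c
  suffices ∃ d, ∀ x y, dist x y ≤ d ↔ c.r x y by
    obtain ⟨d, hd⟩ := this
    exact ⟨d, latticeCon_toSetoid_injective (Setoid.ext hd)⟩
  by_cases hc : c.r ⊥ ⊤
  · exact ⟨⊤, fun x y => iff_of_true le_top (latticeCon_rel_of_rel_bot_top hc x y)⟩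
  set d := (Finset.univ.filter (Collapses c)).sup C.col with hd
  have le_d {p : D} (hp : SupIrred p) : p ≤ d ↔ ∃ v, Collapses c v ∧ p ≤ C.col v := by
    simp [hd, (supPrime_iff_supIrred.2 hp).le_finset_sup]
  have col_le_d (v : V) : C.col v ≤ d ↔ Collapses c v :=
    (le_d (hcol v)).trans ⟨fun ⟨_, hw, hvw⟩ => hw.of_le hvw, fun hv => ⟨v, hv, le_rfl⟩⟩
  have hd_top : ¬ ⊤ ≤ d := by
    rw [← hu 0, col_le_d]
    exact fun h => h.1 (hu 0)
  refine ⟨d, fun x y => ?_⟩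
  by_cases hxy : supp x = supp y
  · rw [dist, if_pos hxy, Finset.sup_le_iff]
    simp only [col_le_d]
    exact ⟨rel_of_supp_eq hxy, fun h v hv => collapses_of_mem_symmDiff h hxy hv⟩
  · rw [dist, if_neg hxy]
    exact iff_of_false hd_top fun h => hc (rel_bot_top_of_supp_ne u hu h hxy)

end ColoredComplex

section Representation

variable {V D : Type*} [Lattice D] [BoundedOrder D] {col : V → D} {Q : Set D}

/-- All joins of colours of vertices of `s` belong to `Q`, so that the distances between cells with
face `s` do, and `s` is a singleton if it has a vertex of colour `⊤`. -/
def IsJoinFace (col : V → D) (Q : Set D) (s : Finset V) : Prop :=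
  (∀ v ∈ s, col v = ⊤ → s ⊆ {v}) ∧ ∀ r ⊆ s, r.Nonempty → r.sup col ∈ Q

theorem IsJoinFace.mono {s t : Finset V} (hs : IsJoinFace col Q s) (hts : t ⊆ s) :
    IsJoinFace col Q t :=
  ⟨fun v hv h => hts.trans (hs.1 v (hts hv) h), fun r hr => hs.2 r (hr.trans hts)⟩

theorem isJoinFace_singleton {v : V} (hv : col v ∈ Q) : IsJoinFace col Q {v} := by
  refine ⟨by simp, fun r hr hne => ?_⟩
  rwa [hne.subset_singleton_iff.1 hr, Finset.sup_singleton]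

variable [DecidableEq V]

theorem isJoinFace_pair {v w : V} (hv : col v ∈ Q) (hw : col w ∈ Q) (hvw : col v ⊔ col w ∈ Q)
    (hvt : col v ≠ ⊤) (hwt : col w ≠ ⊤) : IsJoinFace col Q {v, w} := by
  refine ⟨by simp [hvt, hwt], fun r hr hne => ?_⟩
  obtain rfl | rfl | rfl : r = {v} ∨ r = {w} ∨ r = {v, w} := by grind
  all_goals simpa

/-- The complex whose faces are the sets of `IsJoinFace`, so that the distances in its lattice of
cells belong to `Q`. -/
def joinComplex (col : V → D) (Q : Set D) (hQ : ∀ v, col v ∈ Q) : ColoredComplex V D where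
  col := col
  faces := ⟨{s | IsJoinFace col Q s}, fun _ _ hts hs => hs.mono hts⟩
  empty_mem := by
    refine ⟨by simp, fun r hr hne => ?_⟩
    simp_all
  singleton_mem v := isJoinFace_singleton (hQ v)
  pair_mem {v w} hwv hv := isJoinFace_pair (hQ v) (hQ w) (by rw [sup_eq_left.2 hwv]; exact hQ v)
    hv (ne_top_of_le_ne_top hv hwv)
  subset_singleton hs _ hv hvt := hs.1 _ hv hvt

open ColoredComplex Cell in
theorem mem_iff_exists_joinComplex_dist_eq (hQ : ∀ v, col v ∈ Q) (hbot : ⊥ ∈ Q) (htop : ⊤ ∈ Q)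
    (hsup : ∀ d, d ≠ ⊥ → ∃ v w, col v ⊔ col w = d) (d : D) :
    d ∈ Q ↔ ∃ x y : WithTop (joinComplex col Q hQ).Cell, ColoredComplex.dist x y = d := by
  constructor
  · intro hd
    rcases eq_or_ne d ⊤ with rfl | hdt
    · exact ⟨⊥, ⊤, if_neg (WithTop.coe_ne_top)⟩
    rcases eq_or_ne d ⊥ with rfl | hdb
    · exact ⟨⊥, ⊥, ColoredComplex.dist_self _⟩
    obtain ⟨v, w, rfl⟩ := hsup d hdb
    have hv : col v ≠ ⊤ := fun h => hdt (by simp [h])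
    have hw : col w ≠ ⊤ := fun h => hdt (by simp [h])
    have hface : {v, w} ∈ (joinComplex col Q hQ).faces := isJoinFace_pair (hQ v) (hQ w) hd hv hw
    have hdist := dist_low_high hface (by simp [joinComplex, hv, hw])
    exact ⟨low {v, w} hface, high {v, w} hface, by simpa [joinComplex] using hdist⟩
  · rintro ⟨x, y, rfl⟩
    by_cases hxy : supp x = supp y
    · obtain rfl | ⟨a, b, rfl, rfl, hab⟩ := eq_or_exists_of_supp_eq hxy
      · rwa [ColoredComplex.dist_self]
      · rw [dist_coe hab]
        rcases (a.up ∆ b.up).eq_empty_or_nonempty with h | h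
        · rwa [h, Finset.sup_empty]
        · have hsub : a.up ∆ b.up ⊆ a.base := symmDiff_le_sup.trans
            (Finset.union_subset a.up_subset (hab ▸ b.up_subset))
          exact a.base_mem.2 _ hsub h
    · rwa [ColoredComplex.dist, if_neg hxy]

end Representation

theorem fullyFLRepresentable_of_subsingleton {D : Type d} [Lattice D] [BoundedOrder D]
    [Subsingleton D] : FullyFLRepresentable D := by
  intro Q hQ
  have hbot : ⊥ ∈ Q := hQ (Or.inr (Or.inl rfl))
  let total : LatticeCon PUnit :=
    { r := fun _ _ => True
      iseqv := ⟨fun _ => trivial, fun _ => trivial, fun _ _ => trivial⟩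
      inf := fun _ _ => trivial
      sup := fun _ _ => trivial }
  refine ⟨PUnit, inferInstance, inferInstance, inferInstance,
    latticeRepresents_of_dist (fun _ _ => ⊥) (fun _ => total) (fun _ _ _ => by simp)
      (fun c => ⟨⊥, latticeCon_toSetoid_injective (Setoid.ext fun x y => ?_)⟩) (fun d => ?_) ?_⟩
  · exact iff_of_true trivial (c.iseqv.refl x)
  · exact iff_of_true (Subsingleton.elim ⊥ d ▸ hbot) ⟨⊥, ⊥, Subsingleton.elim _ _⟩
  · exact fun p _ => Subsingleton.elim ⊥ p ▸ hbot

theorem exists_supIrred_sup_eq {D : Type*} [Lattice D] [BoundedOrder D] {d : D}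
    (hd : ∃ p ∈ J₀ D, ∃ q ∈ J₀ D, p ⊔ q = d) (hd₀ : d ≠ ⊥) :
    ∃ p q, SupIrred p ∧ SupIrred q ∧ p ⊔ q = d := by
  obtain ⟨p, hp | rfl, q, hq | rfl, rfl⟩ := hd
  · exact ⟨p, q, hp, hq, rfl⟩
  · exact ⟨p, p, hp, hp, by simp⟩
  · exact ⟨q, q, hq, hq, by simp⟩
  · simp at hd₀

theorem fullyFLRepresentable_of_sup_eq {D : Type d} [DistribLattice D] [BoundedOrder D] [Finite D]
    (htop : ⊤ ∈ J₀ D) (hsup : ∀ T : D, ∃ p ∈ J₀ D, ∃ q ∈ J₀ D, p ⊔ q = T) :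
    FullyFLRepresentable D := by
  rcases htop with htop | htop
  · intro Q hQ
    obtain ⟨n, ⟨e⟩⟩ := Finite.exists_equiv_fin {p : D // SupIrred p}
    let col (v : Fin n × Fin 3) : D := e.symm v.1
    have hcol (v : Fin n × Fin 3) : SupIrred (col v) := (e.symm v.1).2
    have exists_col_eq {p : D} (hp : SupIrred p) : ∃ v, col v = p := ⟨(e ⟨p, hp⟩, 0), by simp [col]⟩
    let C := joinComplex col Q fun v => hQ (Or.inl (hcol v))
    let u : Fin 3 ↪ Fin n × Fin 3 := .sectR (e ⟨⊤, htop⟩) (Fin 3)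
    have hu (i : Fin 3) : col (u i) = ⊤ := by simp [col, u]
    refine ⟨WithTop C.Cell, inferInstanceAs (Finite (Option C.Cell)), ⟨⊤⟩, inferInstance,
      latticeRepresents_of_dist ColoredComplex.dist C.con (fun _ _ _ => Iff.rfl)
        (ColoredComplex.con_surjective hcol u hu)
        (mem_iff_exists_joinComplex_dist_eq _ (hQ (Or.inr (Or.inl rfl)))
          (hQ (Or.inr (Or.inr rfl))) fun d hd => ?_) fun p hp => hQ (Or.inl hp)⟩
    obtain ⟨p, q, hp, hq, rfl⟩ := exists_supIrred_sup_eq (hsup d) hd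
    obtain ⟨⟨v, rfl⟩, ⟨w, rfl⟩⟩ := And.intro (exists_col_eq hp) (exists_col_eq hq)
    exact ⟨v, w, rfl⟩
  · have : Subsingleton D := subsingleton_of_bot_eq_top (Set.mem_singleton_iff.1 htop).symm
    exact fullyFLRepresentable_of_subsingleton

end PrincCong

theorem corollary1p4 (D : Type d) [DistribLattice D] [BoundedOrder D] [Finite D]
    (hD : PrincCong.FullyARepresentable.{u, w, d} D) : PrincCong.FullyFLRepresentable.{d} D := by
  exact PrincCong.fullyFLRepresentable_of_sup_eq hD.top_mem_J₀ hD.exists_sup_eq
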